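/- The category $\mathsf{KAlgFrm_S}$ is equivalent to $\mathsf{BDMS_S}$ and dually equivalent to $\mathsf{GPS_S}$; consequently $\mathsf{BDMS_S}$ is dually equivalent to $\mathsf{GPS_S}$ (the Bezhanishvili–Jansana duality). The three categories are the following. (1) Objects of $\mathsf{KAlgFrm_S}$ are compact algebraic frames: complete lattices $L$ satisfying $a\wedge\bigvee S=\bigvee\{a\wedge s\mid s\in S\}$ for all $a\in L$, $S\subseteq L$, in which every element is a join of compact elements and the top element is compact. Write $K(L)$ for the set of compact elements of $L$. Morphisms $\alpha:L_1\to L_2$ are the maps that preserve arbitrary joins, send compact elements to compact elements, and satisfy $\alpha(\bigwedge S)=\bigwedge\alpha[S]$ for every finite (possibly empty) $S\subseteq K(L_1)$ with $\bigwedge S\in K(L_1)$. (2) Objects of $\mathsf{BDMS_S}$ are bounded distributive meet-semilattices: meet-semilattices $M$ with top and bottom such that whenever $a\wedge b\le c$ in $M$, there are $a'\ge a$ and $b'\ge b$ in $M$ with $a'\wedge b'=c$. Morphisms are sup-homomorphisms: maps preserving all finite meets (including the top) and all existing finite joins (including the bottom). (3) Objects of $\mathsf{GPS_S}$ are generalized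 Priestley spaces: tuples $\langle X,\tau,\le,X_0\rangle$, with $X_0\subseteq X$, such that - $\langle X,\tau,\le\rangle$ is a Priestley space, i.e. $\langle X,\tau\rangle$ is compact, $\le$ is a partial order, and whenever $x\not\le y$ there is a clopen upset containing $x$ and missing $y$; - $X_0$ is topologically dense in $X$, and each $x\in X$ lies below some $y\in X_0$; - $x\in X_0$ if and only if $\{U\in\mathcal A(X)\mid x\notin U\}$ is directed under inclusion; - $x\le y$ if and only if every $U\in\mathcal A(X)$ containing $x$ contains $y$. Here $\mathcal A(X)$ is the set of admissible clopen upsets of $X$, a clopen upset $U$ being admissible if every maximal element of $X\setminus U$ belongs to $X_0$. Morphisms are strong Priestley morphisms: order-preserving maps $f:X\to Y$ such that $f^{-1}(U)\in\mathcal A(X)$ for each $U\in\mathcal A(Y)$. Composition is composition of functions. -/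

import Mathlib

open CategoryTheory

universe u

/-! ## Compact algebraic frames -/

/-- A compact algebraic frame: a frame in which every element is a join of compact elements and
whose top element is compact. -/
structure KAlgFrmS : Type (u + 1) where
  carrier : Type u
  [frame : Order.Frame carrier]
  [algebraic : IsCompactlyGenerated carrier]
  isCompactElement_top : IsCompactElement (⊤ : carrier)

namespace KAlgFrmS

instance : CoeSort KAlgFrmS.{u} (Type u) := ⟨carrier⟩

attribute [instance] frame algebraic

/-- Maps preserving arbitrary joins, compact elements, and those finite meets of compact elements
that are compact (including the empty meet). -/
@[ext]
structure Hom (L M : KAlgFrmS.{u}) : Type u where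
  toFun : L → M
  map_sSup : ∀ S : Set L, toFun (sSup S) = sSup (toFun '' S)
  map_compact : ∀ k : L, IsCompactElement k → IsCompactElement (toFun k)
  map_sInf : ∀ S : Set L, S.Finite → (∀ k ∈ S, IsCompactElement k) →
    IsCompactElement (sInf S) → toFun (sInf S) = sInf (toFun '' S)

/-- The category of compact algebraic frames. -/
instance : Category.{u} KAlgFrmS.{u} where
  Hom := Hom
  id L :=
    { toFun := id
      map_sSup := fun S => by simp
      map_compact := fun _ hk => hk
      map_sInf := fun S _ _ _ => by simp }
  comp f g :=
    { toFun := g.toFun ∘ f.toFun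
      map_sSup := fun S => by
        rw [Set.image_comp, Function.comp_apply, f.map_sSup, g.map_sSup]
      map_compact := fun k hk => g.map_compact _ (f.map_compact k hk)
      map_sInf := fun S hS hk hI => by
        rw [Set.image_comp, Function.comp_apply, f.map_sInf S hS hk hI]
        refine g.map_sInf _ (hS.image _) ?_ ?_
        · rintro _ ⟨k, hkS, rfl⟩
          exact f.map_compact k (hk k hkS)
        · rw [← f.map_sInf S hS hk hI]
          exact f.map_compact _ hI }

end KAlgFrmS

/-! ## Bounded distributive meet-semilattices -/

/-- A bounded distributive meet-semilattice. -/
structure BDMSS : Type (u + 1) where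
  carrier : Type u
  [semilatticeInf : SemilatticeInf carrier]
  [boundedOrder : BoundedOrder carrier]
  distrib : ∀ a b c : carrier, a ⊓ b ≤ c → ∃ a' b' : carrier, a ≤ a' ∧ b ≤ b' ∧ a' ⊓ b' = c

namespace BDMSS

instance : CoeSort BDMSS.{u} (Type u) := ⟨carrier⟩

attribute [instance] semilatticeInf boundedOrder

/-- Sup-homomorphisms: maps preserving all finite meets and all existing finite joins
(including the empty meet `⊤` and the empty join `⊥`). -/
@[ext]
structure Hom (M N : BDMSS.{u}) : Type u where
  toFun : M → N
  map_top : toFun ⊤ = ⊤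
  map_inf : ∀ a b : M, toFun (a ⊓ b) = toFun a ⊓ toFun b
  map_isLUB : ∀ (S : Set M) (a : M), S.Finite → IsLUB S a → IsLUB (toFun '' S) (toFun a)

/-- The category of bounded distributive meet-semilattices and sup-homomorphisms. -/
instance : Category.{u} BDMSS.{u} where
  Hom := Hom
  id M :=
    { toFun := id
      map_top := rfl
      map_inf := fun _ _ => rfl
      map_isLUB := fun S a _ h => by simpa using h }
  comp f g :=
    { toFun := g.toFun ∘ f.toFun
      map_top := by rw [Function.comp_apply, f.map_top, g.map_top]
      map_inf := fun a b => by simp only [Function.comp_apply, f.map_inf, g.map_inf]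
      map_isLUB := fun S a hS h => by
        rw [Set.image_comp]
        exact g.map_isLUB _ _ (hS.image _) (f.map_isLUB S a hS h) }

end BDMSS

/-! ## Generalized Priestley spaces -/

section Admissible

variable {X : Type u} [TopologicalSpace X] [PartialOrder X]

/-- A clopen upset `U` is admissible, relative to a subset `X₀`, if every maximal element of its
complement lies in `X₀`. -/
def IsAdmissible (X₀ U : Set X) : Prop :=
  IsClopen U ∧ IsUpperSet U ∧ ∀ x, Maximal (fun y => y ∈ Uᶜ) x → x ∈ X₀

/-- The family of admissible clopen upsets not containing `x`. -/
def admissibleMissing (X₀ : Set X) (x : X) : Set (Set X) :=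
  {U | IsAdmissible X₀ U ∧ x ∉ U}

end Admissible

/-- A generalized Priestley space `⟨X, τ, ≤, X₀⟩`. -/
structure GPSS : Type (u + 1) where
  carrier : Type u
  [topologicalSpace : TopologicalSpace carrier]
  [partialOrder : PartialOrder carrier]
  [compactSpace : CompactSpace carrier]
  [priestleySpace : PriestleySpace carrier]
  X₀ : Set carrier
  dense : Dense X₀
  order_dense : ∀ x : carrier, ∃ y ∈ X₀, x ≤ y
  mem_iff_directed : ∀ x : carrier, x ∈ X₀ ↔ DirectedOn (· ⊆ ·) (admissibleMissing X₀ x)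
  le_iff : ∀ x y : carrier, x ≤ y ↔ ∀ U : Set carrier, IsAdmissible X₀ U → x ∈ U → y ∈ U

namespace GPSS

instance : CoeSort GPSS.{u} (Type u) := ⟨carrier⟩

attribute [instance] topologicalSpace partialOrder compactSpace priestleySpace

/-- Strong Priestley morphisms: order-preserving maps under which preimages of admissible clopen
upsets are admissible clopen upsets. -/
@[ext]
structure Hom (X Y : GPSS.{u}) : Type u where
  toFun : X → Y
  monotone : Monotone toFun
  preimage_admissible : ∀ U : Set Y, IsAdmissible Y.X₀ U → IsAdmissible X.X₀ (toFun ⁻¹' U)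

/-- The category of generalized Priestley spaces and strong Priestley morphisms. -/
instance : Category.{u} GPSS.{u} where
  Hom := Hom
  id X :=
    { toFun := id
      monotone := monotone_id
      preimage_admissible := fun _ hU => hU }
  comp f g :=
    { toFun := g.toFun ∘ f.toFun
      monotone := g.monotone.comp f.monotone
      preimage_admissible := fun U hU =>
        f.preimage_admissible _ (g.preimage_admissible U hU) }

end GPSS

/-! An algebraic frame is determined by its compact elements. They form a join-semilattice in which
an element below `a ⊔ b` splits (`CompactElt.exists_sup_eq`), so their order dual is distributive.
Conversely `M` is the dual of the compact elements of its frame of filters. Morphisms match because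
an infimum that exists among compact elements is the infimum in the frame (`CompactElt.isGLB_iff`).

For the duality, `M` goes to its optimal filters, a closed subspace of a Cantor cube, with the prime
filters as `X₀`. Distributivity gives enough prime filters (`IsMeetFilter.exists_isPrimeFilter`),
hence their density; compactness shows that the admissible upsets are exactly the sets `basic a`
(`OptSpec.isAdmissible_iff`), which yields full faithfulness. Every space `X` arises from its
semilattice of admissible upsets: points give optimal filters because `X₀` is dense, and compactness
gives all of them (`toSpec_surjective`). The second equivalence is the composite of the other two.
-/

/-! ## Compact elements of a complete lattice -/

section CompactElements

variable {α : Type*} [CompleteLattice α]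

theorem isCompactElement_bot : IsCompactElement (⊥ : α) := by
  simpa using CompleteLattice.isCompactElement_finsetSup (∅ : Finset α) (f := id) (by simp)

theorem IsCompactElement.sup' {a b : α} (ha : IsCompactElement a) (hb : IsCompactElement b) :
    IsCompactElement (a ⊔ b) := by
  classical
  simpa using CompleteLattice.isCompactElement_finsetSup ({a, b} : Finset α) (f := id) (by simp [ha, hb])

variable (α) in
/-- The compact elements of a complete lattice. -/
abbrev CompactElt : Type _ := {k : α // IsCompactElement k}

namespace CompactElt

instance : SemilatticeSup (CompactElt α) :=
  Subtype.semilatticeSup fun {_ _} ha hb => IsCompactElement.sup' ha hb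

instance : OrderBot (CompactElt α) :=
  Subtype.orderBot isCompactElement_bot

/-- The join in `β` of the images of the compact elements below `x`. -/
def extend {β : Type*} [CompleteLattice β] (h : CompactElt α → β) (x : α) : β :=
  sSup {y | ∃ k : CompactElt α, (k : α) ≤ x ∧ h k = y}

theorem le_extend {β : Type*} [CompleteLattice β] (h : CompactElt α → β) {k : CompactElt α}
    {x : α} (hk : (k : α) ≤ x) : h k ≤ extend h x :=
  le_sSup ⟨k, hk, rfl⟩

theorem extend_le {β : Type*} [CompleteLattice β] {h : CompactElt α → β} {x : α} {y : β}
    (hy : ∀ k : CompactElt α, (k : α) ≤ x → h k ≤ y) : extend h x ≤ y :=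
  sSup_le fun _ ⟨k, hk, e⟩ => e ▸ hy k hk

theorem extend_mono {β : Type*} [CompleteLattice β] (h : CompactElt α → β) :
    Monotone (extend h) :=
  fun _ _ hxy => extend_le fun _ hk => le_extend h (hk.trans hxy)

theorem extend_coe {β : Type*} [CompleteLattice β] {h : CompactElt α → β} (hm : Monotone h)
    (k : CompactElt α) : extend h k = h k :=
  le_antisymm (extend_le fun _ hl => hm hl) (le_extend h le_rfl)

variable [IsCompactlyGenerated α]

theorem le_iff_forall_coe_le {x y : α} : x ≤ y ↔ ∀ k : CompactElt α, (k : α) ≤ x → (k : α) ≤ y :=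
  le_iff_compact_le_imp.trans ⟨fun h k => h k k.2, fun h k hk => h ⟨k, hk⟩⟩

/-- A compact element below a join is below a finite join of compact elements that are below
members of the family; stated as an induction principle. -/
theorem mem_of_le_sSup {S : Set α} {p : CompactElt α → Prop} (bot : p ⊥)
    (sup : ∀ a b, p a → p b → p (a ⊔ b)) (mono : ∀ a b, a ≤ b → p b → p a)
    (mem : ∀ s ∈ S, ∀ k : CompactElt α, (k : α) ≤ s → p k)
    {k : CompactElt α} (hk : (k : α) ≤ sSup S) : p k := by
  classical
  -- Closure of `p` under joins makes `D` directed, so compactness of `k` puts it below a single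
  -- member.
  let D : Set α := {x | ∃ l : CompactElt α, p l ∧ (l : α) = x}
  have hD : sSup S ≤ sSup D :=
    sSup_le fun s hs => le_iff_forall_coe_le.2 fun l hl => le_sSup ⟨l, mem s hs l hl, rfl⟩
  have hdir : DirectedOn (· ≤ ·) D := by
    rintro _ ⟨a, ha, rfl⟩ _ ⟨b, hb, rfl⟩
    exact ⟨_, ⟨a ⊔ b, sup a b ha hb, rfl⟩, le_sup_left, le_sup_right⟩
  obtain ⟨_, ⟨l, hl, rfl⟩, hkl⟩ := (CompleteLattice.isCompactElement_iff_le_of_directed_sSup_le α (k : α)).1 k.2 D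
    ⟨_, ⊥, bot, rfl⟩ hdir (hk.trans hD)
  exact mono k l hkl hl

theorem extend_sSup {β : Type*} [CompleteLattice β] {h : CompactElt α → β} (hbot : h ⊥ = ⊥)
    (hsup : ∀ a b, h (a ⊔ b) = h a ⊔ h b) (S : Set α) :
    extend h (sSup S) = sSup (extend h '' S) := by
  have hm : Monotone h := fun a b hab => by
    rw [← sup_eq_right.2 hab, hsup]; exact le_sup_left
  refine le_antisymm (extend_le fun k hk => ?_) (sSup_le ?_)
  · refine mem_of_le_sSup (p := fun k => h k ≤ sSup (extend h '' S)) (hbot ▸ bot_le)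
      (fun a b ha hb => hsup a b ▸ sup_le ha hb) (fun a b hab hb => (hm hab).trans hb)
      (fun s hs k hk => (le_extend h hk).trans (le_sSup ⟨s, hs, rfl⟩)) hk
  · rintro _ ⟨s, hs, rfl⟩
    exact extend_mono h (le_sSup hs)

/-- Inequalities in `α` are tested on compact elements, so a greatest lower bound among these is the
true infimum. Hence `map_sInf` for frames is preservation of existing finite joins in the order
dual. -/
theorem isGLB_iff {S : Set (CompactElt α)} {k : CompactElt α} :
    IsGLB S k ↔ (k : α) = sInf (Subtype.val '' S) := by
  constructor
  · intro h
    refine le_antisymm (le_sInf ?_) (le_iff_forall_coe_le.2 fun l hl => ?_)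
    · rintro _ ⟨s, hs, rfl⟩
      exact h.1 hs
    · exact h.2 fun s hs => hl.trans (sInf_le ⟨s, hs, rfl⟩)
  · intro h
    refine ⟨fun s hs => ?_, fun l hl => ?_⟩
    · exact Subtype.coe_le_coe.1 (h.le.trans (sInf_le ⟨s, hs, rfl⟩))
    · refine Subtype.coe_le_coe.1 ((le_sInf ?_).trans h.ge)
      rintro _ ⟨s, hs, rfl⟩
      exact hl hs

end CompactElt

end CompactElements

/-- In an algebraic frame, a compact element below a binary join splits. -/
theorem CompactElt.exists_sup_eq {α : Type*} [Order.Frame α] [IsCompactlyGenerated α]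
    {a b c : CompactElt α} (h : c ≤ a ⊔ b) : ∃ a' ≤ a, ∃ b' ≤ b, a' ⊔ b' = c := by
  -- These meets need not be compact; the pieces are found among compact elements below them.
  -- Keeping each piece below `c` turns the final inequality into an equality.
  have hc : (c : α) ≤ sSup {(a : α) ⊓ c, (b : α) ⊓ c} := by
    rw [sSup_pair, ← inf_sup_right]
    exact le_inf h le_rfl
  obtain ⟨a', ha, b', hb, ha', hb', h'⟩ := mem_of_le_sSup
    (p := fun k => ∃ a' ≤ a, ∃ b' ≤ b, a' ≤ c ∧ b' ≤ c ∧ k ≤ a' ⊔ b')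
    ⟨⊥, bot_le, ⊥, bot_le, bot_le, bot_le, bot_le⟩
    (by
      rintro x y ⟨a₁, ha₁, b₁, hb₁, hac₁, hbc₁, h₁⟩ ⟨a₂, ha₂, b₂, hb₂, hac₂, hbc₂, h₂⟩
      exact ⟨a₁ ⊔ a₂, sup_le ha₁ ha₂, b₁ ⊔ b₂, sup_le hb₁ hb₂, sup_le hac₁ hac₂,
        sup_le hbc₁ hbc₂, (sup_le_sup h₁ h₂).trans (sup_sup_sup_comm _ _ _ _).le⟩)
    (fun x y hxy ⟨a', ha, b', hb, hac, hbc, h⟩ => ⟨a', ha, b', hb, hac, hbc, hxy.trans h⟩)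
    (by
      rintro s (rfl | rfl) k hk
      · exact ⟨k, hk.trans inf_le_left, ⊥, bot_le, hk.trans inf_le_right, bot_le, le_sup_left⟩
      · exact ⟨⊥, bot_le, k, hk.trans inf_le_left, bot_le, hk.trans inf_le_right, le_sup_right⟩)
    hc
  exact ⟨a', ha, b', hb, le_antisymm (sup_le ha' hb') h'⟩

theorem BDMSS.Hom.monotone {M N : BDMSS.{u}} (h : Hom M N) : Monotone h.toFun := fun a b hab => by
  rw [← inf_eq_left.2 hab, h.map_inf]
  exact inf_le_right

/-! ## The functor from compact algebraic frames to meet-semilattices -/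

namespace KAlgFrmS

instance (L : KAlgFrmS.{u}) : OrderTop (CompactElt L) :=
  Subtype.orderTop L.isCompactElement_top

instance (L : KAlgFrmS.{u}) : BoundedOrder (CompactElt L) where

theorem Hom.map_sup {L M : KAlgFrmS.{u}} (f : Hom L M) (a b : L) :
    f.toFun (a ⊔ b) = f.toFun a ⊔ f.toFun b := by
  rw [← sSup_pair, f.map_sSup, Set.image_pair, sSup_pair]

theorem Hom.map_bot {L M : KAlgFrmS.{u}} (f : Hom L M) : f.toFun ⊥ = ⊥ := by
  rw [← sSup_empty, f.map_sSup, Set.image_empty, sSup_empty]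

/-- The compact elements of a compact algebraic frame, ordered by the dual order. -/
def compacts (L : KAlgFrmS.{u}) : BDMSS.{u} where
  carrier := (CompactElt L)ᵒᵈ
  distrib a b c h := by
    obtain ⟨a', ha, b', hb, e⟩ := CompactElt.exists_sup_eq (a := OrderDual.ofDual a)
      (b := OrderDual.ofDual b) (c := OrderDual.ofDual c) h
    exact ⟨OrderDual.toDual a', OrderDual.toDual b', ha, hb, congrArg OrderDual.toDual e⟩

/-- The action of a frame homomorphism on compact elements. -/
def Hom.onCompacts {L M : KAlgFrmS.{u}} (f : Hom L M) (k : CompactElt L) : CompactElt M :=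
  ⟨f.toFun k, f.map_compact k k.2⟩

theorem Hom.isGLB_onCompacts {L M : KAlgFrmS.{u}} (f : Hom L M) {S : Set (CompactElt L)}
    {k : CompactElt L} (hS : S.Finite) (h : IsGLB S k) :
    IsGLB (f.onCompacts '' S) (f.onCompacts k) := by
  rw [CompactElt.isGLB_iff] at h ⊢
  have := f.map_sInf (Subtype.val '' S) (hS.image _)
    (by rintro _ ⟨s, _, rfl⟩; exact s.2) (h ▸ k.2)
  rw [← h] at this
  simpa only [Set.image_image, onCompacts] using this

/-- The functor sending a compact algebraic frame to the order dual of its compact elements. -/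
def compactsFunctor : KAlgFrmS.{u} ⥤ BDMSS.{u} where
  obj := compacts
  map {L M} f :=
    { toFun := fun k => OrderDual.toDual (f.onCompacts (OrderDual.ofDual k))
      map_top := congrArg OrderDual.toDual (Subtype.ext f.map_bot)
      map_inf := fun _ _ => congrArg OrderDual.toDual (Subtype.ext (f.map_sup _ _))
      map_isLUB := fun S a hS h => f.isGLB_onCompacts (S := S) (k := a) hS h }

instance : compactsFunctor.{u}.Faithful where
  map_injective {L M} f g h := by
    refine Hom.ext (funext fun x => ?_)
    have key : ∀ k : CompactElt L, f.toFun k = g.toFun k := fun k =>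
      congrArg Subtype.val (congrFun (congrArg BDMSS.Hom.toFun h) (OrderDual.toDual k))
    rw [← sSup_compact_le_eq x, f.map_sSup, g.map_sSup]
    exact congrArg sSup (Set.image_congr fun k hk => key ⟨k, hk.1⟩)

/-- A sup-homomorphism between the compact elements, extended to the frames. -/
def homOfCompacts {L M : KAlgFrmS.{u}} (h : CompactElt L → CompactElt M) (hbot : h ⊥ = ⊥)
    (hsup : ∀ a b, h (a ⊔ b) = h a ⊔ h b)
    (hinf : ∀ (S : Set (CompactElt L)) (k), S.Finite → IsGLB S k → IsGLB (h '' S) (h k)) :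
    Hom L M :=
  have hm : Monotone fun k => (h k : M) := fun a b hab => by
    change h a ≤ h b
    rw [← sup_eq_right.2 hab, hsup]; exact le_sup_left
  { toFun := CompactElt.extend fun k => (h k : M)
    map_sSup := CompactElt.extend_sSup (congrArg _ hbot) fun a b => congrArg _ (hsup a b)
    map_compact := fun k hk => by
      rw [CompactElt.extend_coe hm ⟨k, hk⟩]
      exact (h ⟨k, hk⟩).2
    map_sInf := fun S hS hk hI => by
      lift S to Set (CompactElt L) using hk
      have h₁ := hinf S ⟨_, hI⟩ (hS.of_finite_image Subtype.val_injective.injOn)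
        (CompactElt.isGLB_iff.2 rfl)
      rw [CompactElt.extend_coe hm ⟨_, hI⟩, CompactElt.isGLB_iff.1 h₁, Set.image_image,
        Set.image_image]
      exact congrArg sInf (Set.image_congr fun k _ => (CompactElt.extend_coe hm k).symm) }

instance : compactsFunctor.{u}.Full where
  map_surjective {L M} g := by
    refine ⟨homOfCompacts (fun k => OrderDual.ofDual (g.toFun (OrderDual.toDual k)))
      (congrArg OrderDual.ofDual g.map_top)
      (fun a b => congrArg OrderDual.ofDual (g.map_inf _ _))
      (fun S k hS h => g.map_isLUB S k hS h), ?_⟩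
    refine BDMSS.Hom.ext (funext fun k => ?_)
    refine congrArg OrderDual.toDual (Subtype.ext (CompactElt.extend_coe ?_ _))
    exact fun a b hab => BDMSS.Hom.monotone g (a := OrderDual.toDual b) (b := OrderDual.toDual a) hab

end KAlgFrmS

/-- An order isomorphism is a sup-homomorphism. -/
def BDMSS.homOfOrderIso {M N : BDMSS.{u}} (e : M ≃o N) : M ⟶ N where
  toFun := e
  map_top := e.map_top
  map_inf := e.map_inf
  map_isLUB _ _ _ h := e.isLUB_image'.2 h

/-- The isomorphism given by an order isomorphism. -/
def BDMSS.isoOfOrderIso {M N : BDMSS.{u}} (e : M ≃o N) : M ≅ N where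
  hom := homOfOrderIso e
  inv := homOfOrderIso e.symm
  hom_inv_id := BDMSS.Hom.ext (funext e.symm_apply_apply)
  inv_hom_id := BDMSS.Hom.ext (funext e.apply_symm_apply)

/-! ## The frame of ideals of a distributive join-semilattice -/

namespace Order.Ideal

section

variable {P : Type*} [SemilatticeSup P] [OrderBot P]

/-- The union of a directed family of ideals is already an ideal. -/
theorem mem_sSup_of_directedOn {S : Set (Ideal P)} (hne : S.Nonempty)
    (hS : DirectedOn (· ≤ ·) S) {x : P} (hx : x ∈ sSup S) : ∃ I ∈ S, x ∈ I := by
  let J : Ideal P :=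
    { carrier := {x | ∃ I ∈ S, x ∈ I}
      lower' := fun x y hyx ⟨I, hI, hxI⟩ => ⟨I, hI, I.lower hyx hxI⟩
      nonempty' := hne.elim fun I hI => ⟨⊥, I, hI, I.bot_mem⟩
      directed' := by
        rintro x ⟨I, hI, hxI⟩ y ⟨J, hJ, hyJ⟩
        obtain ⟨K, hK, hIK, hJK⟩ := hS I hI J hJ
        exact ⟨x ⊔ y, ⟨K, hK, sup_mem (hIK hxI) (hJK hyJ)⟩, le_sup_left, le_sup_right⟩ }
  have : sSup S ≤ J := sSup_le fun I hI x hx => ⟨I, hI, hx⟩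
  exact this hx

theorem isCompactElement_principal (p : P) : IsCompactElement (principal p) := by
  rw [CompleteLattice.isCompactElement_iff_le_of_directed_sSup_le]
  intro S hne hS h
  obtain ⟨I, hI, hp⟩ := mem_sSup_of_directedOn hne hS (principal_le_iff.1 h)
  exact ⟨I, hI, principal_le_iff.2 hp⟩

theorem sSup_principal_eq (I : Ideal P) : sSup (principal '' (I : Set P)) = I := by
  refine le_antisymm (sSup_le ?_) fun x hx => ?_
  · rintro _ ⟨x, hx, rfl⟩
    exact principal_le_iff.2 hx
  · exact principal_le_iff.1 (le_sSup ⟨x, hx, rfl⟩)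

/-- An ideal is the directed join of the principal ideals of its members, so a compact one is among
them. -/
theorem isCompactElement_iff_eq_principal {I : Ideal P} :
    IsCompactElement I ↔ ∃ p, principal p = I := by
  refine ⟨fun h => ?_, by rintro ⟨p, rfl⟩; exact isCompactElement_principal p⟩
  rw [CompleteLattice.isCompactElement_iff_le_of_directed_sSup_le] at h
  obtain ⟨_, ⟨p, hp, rfl⟩, hI⟩ := h (principal '' (I : Set P)) (I.nonempty.image _)
    (by
      rintro _ ⟨x, hx, rfl⟩ _ ⟨y, hy, rfl⟩
      exact ⟨_, ⟨x ⊔ y, sup_mem hx hy, rfl⟩, principal_le_iff.2 le_sup_left,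
        principal_le_iff.2 le_sup_right⟩)
    (sSup_principal_eq I).ge
  exact ⟨p, le_antisymm (principal_le_iff.2 hp) hI⟩

instance : IsCompactlyGenerated (Ideal P) where
  exists_sSup_eq I := ⟨principal '' (I : Set P), by
    rintro _ ⟨p, _, rfl⟩
    exact isCompactElement_principal p, sSup_principal_eq I⟩

/-- The elements of a join-semilattice are the compact elements of its lattice of ideals. -/
noncomputable def principalIso : P ≃o CompactElt (Ideal P) :=
  { Equiv.ofBijective
      (fun p => (⟨principal p, isCompactElement_principal p⟩ : CompactElt (Ideal P)))
      ⟨fun _ _ h => le_antisymm (mem_principal.1 (principal_le_iff.1 (Subtype.ext_iff.1 h).le))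
        (mem_principal.1 (principal_le_iff.1 (Subtype.ext_iff.1 h).ge)),
      fun ⟨_, hI⟩ => (isCompactElement_iff_eq_principal.1 hI).imp fun _ h => Subtype.ext h⟩ with
    map_rel_iff' := principal_le_iff.trans mem_principal }

end

/-- If the elements below a binary join split, then the lattice of ideals is a frame. -/
abbrev frameOfSplits {P : Type*} [SemilatticeSup P] [OrderBot P]
    (hP : ∀ a b c : P, c ≤ a ⊔ b → ∃ a' ≤ a, ∃ b' ≤ b, a' ⊔ b' = c) : Order.Frame (Ideal P) :=
  .ofMinimalAxioms
    { inf_sSup_le_iSup_inf := fun I S => by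
        let T : Ideal P := ⨆ J ∈ S, I ⊓ J
        -- `J` is the Heyting implication from `I` to `T`; splitting is exactly what makes it
        -- directed.
        let J : Ideal P :=
          { carrier := {y | ∀ z ≤ y, z ∈ I → z ∈ T}
            lower' := fun _ _ hyx hx z hz => hx z (hz.trans hyx)
            nonempty' := ⟨⊥, fun z hz _ => T.lower hz T.bot_mem⟩
            directed' := fun x hx y hy => by
              refine ⟨x ⊔ y, fun z hz hzI => ?_, le_sup_left, le_sup_right⟩
              obtain ⟨a, ha, b, hb, rfl⟩ := hP x y z hz
              exact sup_mem (hx a ha (I.lower le_sup_left hzI)) (hy b hb (I.lower le_sup_right hzI)) }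
        have hJ : sSup S ≤ J := sSup_le fun K hK y hy z hz hzI =>
          (le_iSup₂_of_le K hK le_rfl : I ⊓ K ≤ T) ⟨hzI, K.lower hz hy⟩
        exact fun x hx => hJ hx.2 x le_rfl hx.1 }

end Order.Ideal

namespace BDMSS

/-- The frame of ideals of the order dual, that is, of filters. -/
def filterFrame (M : BDMSS.{u}) : KAlgFrmS.{u} where
  carrier := Order.Ideal Mᵒᵈ
  frame := Order.Ideal.frameOfSplits fun a b c h => by
    obtain ⟨a', b', ha, hb, e⟩ := M.distrib (OrderDual.ofDual a) (OrderDual.ofDual b)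
      (OrderDual.ofDual c) h
    exact ⟨OrderDual.toDual a', ha, OrderDual.toDual b', hb, congrArg OrderDual.toDual e⟩
  algebraic := inferInstance
  isCompactElement_top := Order.Ideal.isCompactElement_iff_eq_principal.2 ⟨⊤, by simp⟩

end BDMSS

namespace KAlgFrmS

instance : compactsFunctor.{u}.EssSurj where
  mem_essImage M := ⟨M.filterFrame, ⟨BDMSS.isoOfOrderIso
    (OrderIso.dual (Order.Ideal.principalIso (P := Mᵒᵈ)).symm)⟩⟩

instance : compactsFunctor.{u}.IsEquivalence where

end KAlgFrmS

/-! ## Compactness and maximal elements -/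

theorem DirectedOn.exists_forall_rel_of_finite {α : Type*} {r : α → α → Prop} [IsTrans α r]
    {s : Set α} (hs : DirectedOn r s) (hne : s.Nonempty) {t : Set α} (ht : t.Finite)
    (hts : t ⊆ s) : ∃ u ∈ s, ∀ a ∈ t, r a u := by
  induction t, ht using Set.Finite.induction_on with
  | empty => exact hne.imp fun u hu => ⟨hu, by simp⟩
  | @insert a t _ _ ih =>
    obtain ⟨u, hu, hut⟩ := ih ((Set.subset_insert a t).trans hts)
    obtain ⟨v, hv, hav, huv⟩ := hs a (hts (Set.mem_insert a t)) u hu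
    refine ⟨v, hv, fun b hb => ?_⟩
    obtain rfl | hb := hb
    · exact hav
    · exact _root_.trans (hut b hb) huv

/-- A downward directed family of closed sets, such that each point of a compact set is missed by a
member, has a member disjoint from the compact set. -/
theorem IsCompact.exists_disjoint_of_directedOn {X : Type*} [TopologicalSpace X] {K : Set X}
    (hK : IsCompact K) {𝓐 : Set (Set X)} (hne : 𝓐.Nonempty) (hdir : DirectedOn (· ⊇ ·) 𝓐)
    (hcl : ∀ A ∈ 𝓐, IsClosed A) (h : ∀ x ∈ K, ∃ A ∈ 𝓐, x ∉ A) : ∃ A ∈ 𝓐, ∀ x ∈ A, x ∉ K := by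
  have : Nonempty 𝓐 := hne.to_subtype
  obtain ⟨A, hA⟩ := hK.elim_directed_family_closed (fun A : 𝓐 => (A : Set X)) (fun A => hcl A A.2)
    (by
      refine Set.eq_empty_iff_forall_notMem.2 fun x ⟨hx, hx'⟩ => ?_
      obtain ⟨A, hA, hxA⟩ := h x hx
      exact hxA (Set.mem_iInter.1 hx' ⟨A, hA⟩))
    hdir.directed_val
  exact ⟨A, A.2, fun x hxA hxK => (Set.eq_empty_iff_forall_notMem.1 hA x) ⟨hxK, hxA⟩⟩

theorem PriestleySpace.isClosed_Ici {X : Type*} [TopologicalSpace X] [PartialOrder X]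
    [PriestleySpace X] (x : X) : IsClosed (Set.Ici x) := by
  refine isOpen_compl_iff.1 (isOpen_iff_forall_mem_open.2 fun y hy => ?_)
  obtain ⟨U, hU, hup, hx, hyU⟩ := exists_isClopen_upper_of_not_le hy
  exact ⟨Uᶜ, fun z hz hxz => hz (hup hxz hx), hU.compl.isOpen, hyU⟩

/-- Zorn's lemma applies because principal upsets are closed: by compactness, those of a chain in
`K` have a common point in `K`, an upper bound. -/
theorem PriestleySpace.exists_le_maximal {X : Type*} [TopologicalSpace X] [PartialOrder X]
    [CompactSpace X] [PriestleySpace X] {K : Set X} (hK : IsClosed K) {x : X} (hx : x ∈ K) :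
    ∃ m, x ≤ m ∧ Maximal (fun y => y ∈ K) m := by
  refine zorn_le_nonempty₀ K (fun c hcK hc z hz => ?_) x hx
  by_contra! hcon
  obtain ⟨_, ⟨y, hy, rfl⟩, hyK⟩ := hK.isCompact.exists_disjoint_of_directedOn
    (𝓐 := Set.Ici '' c) ⟨_, z, hz, rfl⟩
    (by
      rintro _ ⟨a, ha, rfl⟩ _ ⟨b, hb, rfl⟩
      obtain h | h := hc.total ha hb
      · exact ⟨_, ⟨b, hb, rfl⟩, Set.Ici_subset_Ici.2 h, subset_rfl⟩
      · exact ⟨_, ⟨a, ha, rfl⟩, subset_rfl, Set.Ici_subset_Ici.2 h⟩)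
    (by rintro _ ⟨a, _, rfl⟩; exact isClosed_Ici a)
    (fun y hy => by
      obtain ⟨a, ha, hay⟩ := hcon y hy
      exact ⟨_, ⟨a, ha, rfl⟩, hay⟩)
  exact hyK y le_rfl (hcK hy)

namespace BDMSS

/-! ## Optimal filters -/

variable {M N : BDMSS.{u}}

/-- A set is a filter of a bounded meet-semilattice if it contains `⊤` and contains a meet exactly
when it contains both factors. -/
structure IsMeetFilter (F : Set M) : Prop where
  top_mem : ⊤ ∈ F
  inf_mem_iff : ∀ a b : M, a ⊓ b ∈ F ↔ a ∈ F ∧ b ∈ F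

theorem IsMeetFilter.mem_of_le {F : Set M} (hF : IsMeetFilter F) {a b : M} (hab : a ≤ b)
    (ha : a ∈ F) : b ∈ F :=
  ((hF.inf_mem_iff a b).1 (by rwa [inf_eq_left.2 hab])).2

theorem isMeetFilter_Ici (a : M) : IsMeetFilter (Set.Ici a) :=
  ⟨le_top, fun _ _ => le_inf_iff⟩

/-- A filter is optimal if it contains a member of every finite set `S` for which it contains an
element lying below all upper bounds of `S`. -/
structure IsOptimal (F : Set M) : Prop extends IsMeetFilter F where
  exists_mem : ∀ (S : Finset M) (b : M), b ∈ lowerBounds (upperBounds (S : Set M)) → b ∈ F →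
    ∃ s ∈ S, s ∈ F

/-- A filter is prime if its complement is nonempty and directed. -/
structure IsPrimeFilter (F : Set M) : Prop extends IsMeetFilter F where
  nonempty_compl : Fᶜ.Nonempty
  directedOn_compl : DirectedOn (· ≤ ·) Fᶜ

theorem IsPrimeFilter.isOptimal {F : Set M} (hF : IsPrimeFilter F) : IsOptimal F where
  toIsMeetFilter := hF.toIsMeetFilter
  exists_mem S b hb hbF := by
    by_contra! h
    obtain ⟨u, hu, hSu⟩ := hF.directedOn_compl.exists_forall_rel_of_finite hF.nonempty_compl
      S.finite_toSet h
    exact hu (hF.mem_of_le (hb hSu) hbF)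

theorem IsMeetFilter.exists_isPrimeFilter {F : Set M} (hF : IsMeetFilter F) {c : M} (hc : c ∉ F) :
    ∃ G, F ⊆ G ∧ c ∉ G ∧ IsPrimeFilter G := by
  obtain ⟨G, hFG, hG⟩ := zorn_subset_nonempty {G : Set M | IsMeetFilter G ∧ c ∉ G}
    (by
      refine fun C hC hchain hne => ⟨⋃₀ C, ⟨⟨?_, fun a b => ⟨?_, ?_⟩⟩, ?_⟩,
        fun G hG => Set.subset_sUnion_of_mem hG⟩
      · obtain ⟨G, hG⟩ := hne
        exact ⟨G, hG, (hC hG).1.top_mem⟩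
      · rintro ⟨G, hG, hab⟩
        have := ((hC hG).1.inf_mem_iff a b).1 hab
        exact ⟨⟨G, hG, this.1⟩, ⟨G, hG, this.2⟩⟩
      · rintro ⟨⟨G, hG, ha⟩, ⟨H, hH, hb⟩⟩
        obtain h | h := hchain.total hG hH
        · exact ⟨H, hH, ((hC hH).1.inf_mem_iff a b).2 ⟨h ha, hb⟩⟩
        · exact ⟨G, hG, ((hC hG).1.inf_mem_iff a b).2 ⟨ha, h hb⟩⟩
      · rintro ⟨G, hG, hcG⟩
        exact (hC hG).2 hcG)
    F ⟨hF, hc⟩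
  obtain ⟨⟨hGf, hcG⟩, hmax⟩ := hG
  -- Otherwise the filter generated by `G` and `a` would still avoid `c`, against maximality.
  have key : ∀ a ∉ G, ∃ f ∈ G, a ⊓ f ≤ c := by
    intro a ha
    by_contra! h
    let H : Set M := {x | ∃ f ∈ G, a ⊓ f ≤ x}
    have hH : IsMeetFilter H := by
      refine ⟨⟨⊤, hGf.top_mem, le_top⟩, fun x y => ⟨?_, ?_⟩⟩
      · rintro ⟨f, hf, hxy⟩
        exact ⟨⟨f, hf, hxy.trans inf_le_left⟩, ⟨f, hf, hxy.trans inf_le_right⟩⟩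
      · rintro ⟨⟨f, hf, hx⟩, ⟨g, hg, hy⟩⟩
        exact ⟨f ⊓ g, (hGf.inf_mem_iff f g).2 ⟨hf, hg⟩,
          le_inf ((inf_le_inf_left a inf_le_left).trans hx)
            ((inf_le_inf_left a inf_le_right).trans hy)⟩
    have hle : H ⊆ G := hmax ⟨hH, fun ⟨f, hf, hfc⟩ => h f hf hfc⟩
      fun x hx => ⟨x, hx, inf_le_right⟩
    exact ha (hle ⟨⊤, hGf.top_mem, inf_le_left⟩)
  refine ⟨G, hFG, hcG, hGf, ⟨c, hcG⟩, fun a ha b hb => ?_⟩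
  obtain ⟨f, hf, hafc⟩ := key a ha
  obtain ⟨g, hg, hbgc⟩ := key b hb
  -- Distributivity is used twice: `c = a' ⊓ f'`, and then `b ⊓ g ≤ c ≤ a'` gives `a' = b' ⊓ g'`.
  -- Thus `b'` bounds both `a` and `b`, and `b' ∈ G` would force `a'` and then `c` into `G`.
  obtain ⟨a', f', haa', hff', hc'⟩ := M.distrib a f c hafc
  obtain ⟨b', g', hbb', hgg', ha'⟩ := M.distrib b g a'
    (hbgc.trans (hc' ▸ inf_le_left))
  refine ⟨b', fun hb' => ?_, haa'.trans (ha' ▸ inf_le_left), hbb'⟩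
  refine hcG (hc' ▸ (hGf.inf_mem_iff a' f').2 ⟨?_, hGf.mem_of_le hff' hf⟩)
  exact ha' ▸ (hGf.inf_mem_iff b' g').2 ⟨hb', hGf.mem_of_le hgg' hg⟩

theorem exists_isPrimeFilter_of_not_le {a b : M} (h : ¬a ≤ b) :
    ∃ F : Set M, a ∈ F ∧ b ∉ F ∧ IsPrimeFilter F := by
  obtain ⟨G, hG, hb, hp⟩ := (isMeetFilter_Ici a).exists_isPrimeFilter (c := b) h
  exact ⟨G, hG le_rfl, hb, hp⟩

/-- The join of `S` may not exist, but meeting with `b` produces one that does, which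
sup-homomorphisms must preserve. This is what lets optimality pass to preimages. -/
theorem isLUB_inf_image {S : Set M} (hS : S.Finite) {b : M}
    (hb : b ∈ lowerBounds (upperBounds S)) : IsLUB ((b ⊓ ·) '' S) b := by
  refine ⟨?_, fun c hc => ?_⟩
  · rintro _ ⟨s, _, rfl⟩
    exact inf_le_left
  · by_contra h
    obtain ⟨F, hbF, hcF, hF⟩ := exists_isPrimeFilter_of_not_le h
    obtain ⟨u, hu, hSu⟩ := hF.directedOn_compl.exists_forall_rel_of_finite hF.nonempty_compl hS
      fun s hs hsF => hcF (hF.mem_of_le (hc ⟨s, hs, rfl⟩) ((hF.inf_mem_iff b s).2 ⟨hbF, hsF⟩))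
    exact hu (hF.mem_of_le (hb hSu) hbF)

theorem IsOptimal.preimage (h : Hom M N) {F : Set N} (hF : IsOptimal F) :
    IsOptimal (h.toFun ⁻¹' F) where
  top_mem := by
    rw [Set.mem_preimage, h.map_top]
    exact hF.top_mem
  inf_mem_iff a b := by
    simp only [Set.mem_preimage, h.map_inf, hF.inf_mem_iff]
  exists_mem S b hb hbF := by
    classical
    have h₁ := h.map_isLUB _ _ (S.finite_toSet.image _) (isLUB_inf_image S.finite_toSet hb)
    obtain ⟨t, ht, htF⟩ := hF.exists_mem (S.image fun s => h.toFun (b ⊓ s)) (h.toFun b)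
      (by
        intro c hc
        refine h₁.2 ?_
        rintro _ ⟨_, ⟨s, hs, rfl⟩, rfl⟩
        exact hc (by simpa using ⟨s, hs, rfl⟩)) hbF
    obtain ⟨s, hs, rfl⟩ := Finset.mem_image.1 ht
    exact ⟨s, hs, hF.mem_of_le (h.monotone inf_le_right) htF⟩

/-! ## The space of optimal filters -/

variable (M) in
/-- The optimal filters, as a subspace of the Cantor cube on `M`. -/
abbrev OptSpec : Type u := {x : M → Bool // IsOptimal {a | x a = true}}

namespace OptSpec

/-- The point given by an optimal filter. -/
noncomputable def mk' (F : Set M) (hF : IsOptimal F) : OptSpec M :=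
  open Classical in ⟨fun a => decide (a ∈ F), by simpa using hF⟩

/-- The optimal filters containing `a`. -/
def basic (a : M) : Set (OptSpec M) := {x | x.1 a = true}

@[simp]
theorem mk'_mem_basic {F : Set M} {hF : IsOptimal F} {a : M} : mk' F hF ∈ basic a ↔ a ∈ F := by
  simp [mk', basic]

theorem le_iff {x y : OptSpec M} : x ≤ y ↔ ∀ a : M, x ∈ basic a → y ∈ basic a := Iff.rfl

theorem ext_basic {x y : OptSpec M} (h : ∀ a : M, x ∈ basic a ↔ y ∈ basic a) : x = y :=
  le_antisymm (fun a => (h a).1) fun a => (h a).2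

theorem isClopen_basic (a : M) : IsClopen (basic a) :=
  (isClopen_discrete {true}).preimage ((continuous_apply a).comp continuous_subtype_val)

theorem isUpperSet_basic (a : M) : IsUpperSet (basic a) :=
  fun _ _ hxy hx => hxy a hx

theorem basic_inf (a b : M) : basic (a ⊓ b) = basic a ∩ basic b :=
  Set.ext fun x => x.2.inf_mem_iff a b

theorem basic_top : basic (⊤ : M) = Set.univ :=
  Set.eq_univ_of_forall fun x => x.2.top_mem

theorem basic_subset_basic {a b : M} : basic a ⊆ basic b ↔ a ≤ b := by
  refine ⟨fun h => ?_, fun h x hx => x.2.mem_of_le h hx⟩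
  by_contra hab
  obtain ⟨F, ha, hb, hF⟩ := exists_isPrimeFilter_of_not_le hab
  exact hb (mk'_mem_basic.1 (h (mk'_mem_basic (hF := hF.isOptimal).2 ha)))

theorem basic_injective : Function.Injective (basic (M := M)) := fun _ _ h =>
  le_antisymm (basic_subset_basic.1 h.subset) (basic_subset_basic.1 h.superset)

/-- Each defining condition involves only finitely many coordinates. -/
theorem isClosed_setOf_isOptimal : IsClosed {x : M → Bool | IsOptimal {a | x a = true}} := by
  have h : {x : M → Bool | IsOptimal {a | x a = true}} =
      {x | x ⊤ = true} ∩ (⋂ (a : M) (b : M), {x | x (a ⊓ b) = (x a && x b)}) ∩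
      ⋂ (S : Finset M) (b : M) (_ : b ∈ lowerBounds (upperBounds (S : Set M))),
        ({x | x b = false} ∪ ⋃ s ∈ S, {x | x s = true}) := by
    ext x
    simp only [Set.mem_inter_iff, Set.mem_iInter, Set.mem_union, Set.mem_iUnion, Set.mem_ofPred_eq]
    constructor
    · refine fun h => ⟨⟨h.top_mem, fun a b => ?_⟩, fun S b hb => ?_⟩
      · rw [Bool.eq_iff_iff, Bool.and_eq_true]
        exact h.inf_mem_iff a b
      · cases hx : x b
        · exact .inl rfl
        · obtain ⟨s, hs, hxs⟩ := h.exists_mem S b hb hx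
          exact .inr ⟨s, hs, hxs⟩
    · rintro ⟨⟨h₁, h₂⟩, h₃⟩
      refine ⟨⟨h₁, fun a b => ?_⟩, fun S b hb hx => ?_⟩
      · simp [h₂]
      · obtain h | ⟨s, hs, hxs⟩ := h₃ S b hb
        · exact absurd (hx.symm.trans h) (by simp)
        · exact ⟨s, hs, hxs⟩
  rw [h]
  refine ((isClosed_eq (continuous_apply _) continuous_const).inter ?_).inter ?_
  · refine isClosed_iInter fun a => isClosed_iInter fun b => isClosed_eq (continuous_apply _) ?_
    exact (continuous_of_discreteTopology (f := fun p : Bool × Bool => p.1 && p.2)).comp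
      (f := fun x : M → Bool => (x a, x b)) (by fun_prop)
  · refine isClosed_iInter fun S => isClosed_iInter fun b => isClosed_iInter fun _ => ?_
    exact (isClosed_eq (continuous_apply _) continuous_const).union
      (isClosed_biUnion_finset fun s _ => isClosed_eq (continuous_apply _) continuous_const)

instance : CompactSpace (OptSpec M) :=
  isCompact_iff_compactSpace.1 isClosed_setOf_isOptimal.isCompact

instance : PriestleySpace (OptSpec M) where
  priestley {x y} h := by
    rw [le_iff] at h
    push Not at h
    obtain ⟨a, hx, hy⟩ := h
    exact ⟨basic a, isClopen_basic a, isUpperSet_basic a, hx, hy⟩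

variable (M) in
/-- The points given by prime filters. -/
def primes : Set (OptSpec M) := {x | IsPrimeFilter {a | x ∈ basic a}}

theorem exists_primes_mem_basic_of_isMeetFilter {F : Set M} (hF : IsMeetFilter F) {c : M}
    (hc : c ∉ F) : ∃ y ∈ primes M, (∀ a ∈ F, y ∈ basic a) ∧ y ∉ basic c := by
  obtain ⟨G, hFG, hcG, hG⟩ := hF.exists_isPrimeFilter hc
  refine ⟨mk' G hG.isOptimal, ?_, fun a ha => mk'_mem_basic.2 (hFG ha), by simpa using hcG⟩
  simpa [primes] using hG

theorem exists_le_primes_notMem_basic {x : OptSpec M} {c : M} (hc : x ∉ basic c) :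
    ∃ y ∈ primes M, x ≤ y ∧ y ∉ basic c :=
  exists_primes_mem_basic_of_isMeetFilter x.2.toIsMeetFilter hc

theorem notMem_basic_bot (x : OptSpec M) : x ∉ basic ⊥ := fun hx => by
  obtain ⟨s, hs, _⟩ := x.2.exists_mem ∅ ⊥ (fun _ _ => bot_le) hx
  simp at hs

/-- A neighbourhood of `x` fixes finitely many coordinates. By optimality, the meet of those lying
in `x` fails to be below some upper bound `u` of the others; a prime filter separating this meet
from `u` agrees with `x` on all of them. -/
theorem dense_primes : Dense (primes M) := by
  classical
  intro x
  refine mem_closure_iff.2 fun O hO hx => ?_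
  obtain ⟨V, hV, rfl⟩ := isOpen_induced_iff.1 hO
  obtain ⟨I, W, hW, hIW⟩ := isOpen_pi_iff.1 hV x.1 hx
  have hb : x ∈ basic ((I.filter fun a => x ∈ basic a).inf id) := by
    have : ∀ J : Finset M, (∀ a ∈ J, x ∈ basic a) → x ∈ basic (J.inf id) := by
      intro J
      induction J using Finset.induction_on with
      | empty => exact fun _ => by rw [Finset.inf_empty, basic_top]; trivial
      | insert a J _ ih =>
        intro h
        rw [Finset.inf_insert, basic_inf]
        exact ⟨h a (by simp), ih fun b hb => h b (by simp [hb])⟩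
    exact this _ fun a ha => (Finset.mem_filter.1 ha).2
  have hn : ¬(I.filter fun a => x ∈ basic a).inf id ∈
      lowerBounds (upperBounds ((I.filter fun a => x ∉ basic a : Finset M) : Set M)) := by
    intro h
    obtain ⟨s, hs, hxs⟩ := x.2.exists_mem _ _ h hb
    exact (Finset.mem_filter.1 hs).2 hxs
  simp only [mem_lowerBounds, not_forall] at hn
  obtain ⟨u, hu, hbu⟩ := hn
  obtain ⟨y, hy, hby, huy⟩ := exists_primes_mem_basic_of_isMeetFilter (isMeetFilter_Ici _) hbu
  refine ⟨y, hIW fun a ha => ?_, hy⟩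
  have hxy : y.1 a = x.1 a := by
    rw [Bool.eq_iff_iff]
    refine ⟨fun hya => ?_, fun hxa => hby a (Finset.inf_le (f := id) (Finset.mem_filter.2 ⟨ha, hxa⟩))⟩
    by_contra hxa
    exact huy (basic_subset_basic.2 (hu (by simpa using ⟨ha, hxa⟩)) hya)
  rw [hxy]
  exact (hW a ha).2

theorem isAdmissible_basic (a : M) : IsAdmissible (primes M) (basic a) := by
  refine ⟨isClopen_basic a, isUpperSet_basic a, fun x hx => ?_⟩
  obtain ⟨y, hy, hxy, hya⟩ := exists_le_primes_notMem_basic hx.1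
  rwa [le_antisymm hxy (hx.2 hya hxy)]

theorem isAdmissible_iff {U : Set (OptSpec M)} :
    IsAdmissible (primes M) U ↔ ∃ a, basic a = U := by
  refine ⟨fun ⟨hcl, hup, hmax⟩ => ?_, by rintro ⟨a, rfl⟩; exact isAdmissible_basic a⟩
  -- A maximal `x ≥ y` outside `U` is prime by admissibility. The sets `basic a` missing `x` are
  -- therefore directed, and they cover `U` since no point of `U` lies below `x`; so one of them
  -- contains `U`.
  have key : ∀ y ∉ U, ∃ a, U ⊆ basic a ∧ y ∉ basic a := by
    intro y hy
    obtain ⟨x, hyx, hx⟩ := PriestleySpace.exists_le_maximal hcl.compl.isClosed hy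
    have hp := hmax x hx
    obtain ⟨_, ⟨a, ha, rfl⟩, haU⟩ := hcl.isClosed.isCompact.exists_disjoint_of_directedOn
      (𝓐 := (fun a : M => (basic a)ᶜ) '' {a | x ∉ basic a}) (hp.nonempty_compl.image _)
      (by
        rintro _ ⟨a, ha, rfl⟩ _ ⟨b, hb, rfl⟩
        obtain ⟨d, hd, had, hbd⟩ := hp.directedOn_compl a ha b hb
        exact ⟨_, ⟨d, hd, rfl⟩, Set.compl_subset_compl.2 (basic_subset_basic.2 had),
          Set.compl_subset_compl.2 (basic_subset_basic.2 hbd)⟩)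
      (by rintro _ ⟨a, _, rfl⟩; exact (isClopen_basic a).compl.isClosed)
      (fun z hz => by
        have hzx : ¬z ≤ x := fun h => hx.1 (hup h hz)
        rw [le_iff] at hzx
        push Not at hzx
        obtain ⟨a, hza, hxa⟩ := hzx
        exact ⟨_, ⟨a, hxa, rfl⟩, not_not.2 hza⟩)
    refine ⟨a, fun z hz => ?_, fun h => ha (isUpperSet_basic a hyx h)⟩
    by_contra hza
    exact haU z hza hz
  -- By `key`, the sets `basic a` containing `U` intersect in `U`. They are closed under finite
  -- intersections, so compactness of `Uᶜ` makes one of them equal to `U`.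
  obtain ⟨_, ⟨a, ha, rfl⟩, haU⟩ := hcl.compl.isClosed.isCompact.exists_disjoint_of_directedOn
    (𝓐 := basic '' {a : M | U ⊆ basic a})
    ⟨_, ⊤, by rw [Set.mem_ofPred_eq, basic_top]; exact Set.subset_univ _, rfl⟩
    (by
      rintro _ ⟨a, ha, rfl⟩ _ ⟨b, hb, rfl⟩
      exact ⟨_, ⟨a ⊓ b, by rw [Set.mem_ofPred_eq, basic_inf]; exact Set.subset_inter ha hb, rfl⟩,
        basic_subset_basic.2 inf_le_left, basic_subset_basic.2 inf_le_right⟩)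
    (by rintro _ ⟨a, _, rfl⟩; exact (isClopen_basic a).isClosed)
    (fun y hy => by
      obtain ⟨a, ha, hya⟩ := key y hy
      exact ⟨_, ⟨a, ha, rfl⟩, hya⟩)
  exact ⟨a, subset_antisymm (fun x hx => not_not.1 (haU x hx)) ha⟩

theorem mem_primes_iff {x : OptSpec M} :
    x ∈ primes M ↔ DirectedOn (· ⊆ ·) (admissibleMissing (primes M) x) := by
  constructor
  · rintro hp U ⟨hU, hxU⟩ V ⟨hV, hxV⟩
    obtain ⟨a, rfl⟩ := isAdmissible_iff.1 hU
    obtain ⟨b, rfl⟩ := isAdmissible_iff.1 hV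
    obtain ⟨d, hd, had, hbd⟩ := hp.directedOn_compl a hxU b hxV
    exact ⟨basic d, ⟨isAdmissible_basic d, hd⟩, basic_subset_basic.2 had,
      basic_subset_basic.2 hbd⟩
  · intro h
    refine ⟨x.2.toIsMeetFilter, ⟨⊥, notMem_basic_bot x⟩, fun a ha b hb => ?_⟩
    obtain ⟨_, ⟨hU, hxU⟩, haU, hbU⟩ := h _ ⟨isAdmissible_basic a, ha⟩ _ ⟨isAdmissible_basic b, hb⟩
    obtain ⟨d, rfl⟩ := isAdmissible_iff.1 hU
    exact ⟨d, hxU, basic_subset_basic.1 haU, basic_subset_basic.1 hbU⟩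

end OptSpec

/-- The generalized Priestley space of optimal filters. -/
def spec (M : BDMSS.{u}) : GPSS.{u} where
  carrier := OptSpec M
  X₀ := OptSpec.primes M
  dense := OptSpec.dense_primes
  order_dense x := by
    obtain ⟨y, hy, hxy, _⟩ := OptSpec.exists_le_primes_notMem_basic (OptSpec.notMem_basic_bot x)
    exact ⟨y, hy, hxy⟩
  mem_iff_directed _ := OptSpec.mem_primes_iff
  le_iff x y := ⟨fun h _ hU hx => hU.2.1 h hx,
    fun h a hx => h _ (OptSpec.isAdmissible_basic a) hx⟩

/-- The preimage of optimal filters under a sup-homomorphism. -/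
def OptSpec.comap (h : Hom M N) (x : OptSpec N) : OptSpec M :=
  ⟨fun a => x.1 (h.toFun a), IsOptimal.preimage h x.2⟩

/-- The functor sending a bounded distributive meet-semilattice to its space of optimal filters. -/
def specFunctor : BDMSS.{u}ᵒᵖ ⥤ GPSS.{u} where
  obj M := M.unop.spec
  map h :=
    { toFun := OptSpec.comap h.unop
      monotone := fun _ _ hxy _ => hxy _
      preimage_admissible := fun U hU => by
        obtain ⟨a, rfl⟩ := OptSpec.isAdmissible_iff.1 hU
        exact OptSpec.isAdmissible_basic (h.unop.toFun a) }

/-! ### Full faithfulness of the spectrum functor -/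

instance : specFunctor.{u}.Faithful where
  map_injective {N M} f g h := by
    refine Quiver.Hom.unop_inj (Hom.ext (funext fun a => OptSpec.basic_injective ?_))
    ext x
    have := congrArg (fun y : OptSpec M.unop => y.1 a) (congrFun (congrArg GPSS.Hom.toFun h) x)
    exact Bool.eq_iff_iff.1 this

/-- The sup-homomorphism dual to a strong Priestley morphism. -/
def homOfBasic (f : OptSpec N → OptSpec M) (h : M → N)
    (hf : ∀ a x, x ∈ OptSpec.basic (h a) ↔ f x ∈ OptSpec.basic a) : Hom M N where
  toFun := h
  map_top := OptSpec.basic_injective <| by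
    ext x
    rw [hf, OptSpec.basic_top, OptSpec.basic_top]
    simp
  map_inf a b := OptSpec.basic_injective <| by
    ext x
    rw [hf, OptSpec.basic_inf, OptSpec.basic_inf, Set.mem_inter_iff, Set.mem_inter_iff, hf, hf]
  map_isLUB S a hS ha := by
    refine ⟨?_, fun c hc => OptSpec.basic_subset_basic.1 fun x hx => ?_⟩
    · rintro _ ⟨s, hs, rfl⟩
      exact OptSpec.basic_subset_basic.1 fun x hx =>
        (hf a x).2 (OptSpec.basic_subset_basic.2 (ha.1 hs) ((hf s x).1 hx))
    -- Optimality of the filter `f x` is what makes existing finite joins preserved.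
    · obtain ⟨s, hs, hxs⟩ := (f x).2.exists_mem hS.toFinset a
        (by rw [hS.coe_toFinset]; exact ha.2) ((hf a x).1 hx)
      exact OptSpec.basic_subset_basic.2 (hc ⟨s, hS.mem_toFinset.1 hs, rfl⟩) ((hf s x).2 hxs)

instance : specFunctor.{u}.Full where
  map_surjective {N M} f := by
    have hex : ∀ a : M.unop, ∃ b : N.unop, OptSpec.basic b = f.toFun ⁻¹' OptSpec.basic a :=
      fun a => OptSpec.isAdmissible_iff.1 (f.preimage_admissible _ (OptSpec.isAdmissible_basic a))
    choose h hh using hex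
    refine ⟨Quiver.Hom.op (homOfBasic f.toFun h fun a x => Set.ext_iff.1 (hh a) x),
      GPSS.Hom.ext (funext fun x => OptSpec.ext_basic fun a => Set.ext_iff.1 (hh a) x)⟩

end BDMSS

/-! ## The semilattice of admissible clopen upsets -/

namespace IsAdmissible

variable {X : Type u} [TopologicalSpace X] [PartialOrder X] {X₀ U V : Set X}

theorem inter (hU : IsAdmissible X₀ U) (hV : IsAdmissible X₀ V) : IsAdmissible X₀ (U ∩ V) := by
  refine ⟨hU.1.inter hV.1, hU.2.1.inter hV.2.1, fun x hx => ?_⟩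
  by_cases hxU : x ∈ U
  · exact hV.2.2 x ⟨fun hxV => hx.1 ⟨hxU, hxV⟩, fun y hy hxy => hx.2 (fun h => hy h.2) hxy⟩
  · exact hU.2.2 x ⟨hxU, fun y hy hxy => hx.2 (fun h => hy h.1) hxy⟩

theorem univ : IsAdmissible X₀ Set.univ :=
  ⟨isClopen_univ, isUpperSet_univ, fun _ hx => absurd (Set.mem_univ _) hx.1⟩

theorem empty (h : ∀ x : X, ∃ y ∈ X₀, x ≤ y) : IsAdmissible X₀ ∅ := by
  refine ⟨isClopen_empty, isUpperSet_empty, fun x hx => ?_⟩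
  obtain ⟨y, hy, hxy⟩ := h x
  rwa [le_antisymm hxy (hx.2 (Set.notMem_empty y) hxy)]

end IsAdmissible

/-! ### Distributivity of the admissible upsets and recovery of the space -/

namespace GPSS

variable {X : GPSS.{u}}

theorem exists_isAdmissible_of_finite {x : X} (hx : x ∈ X.X₀) {S : Set (Set X)} (hS : S.Finite)
    (h : ∀ U ∈ S, IsAdmissible X.X₀ U ∧ x ∉ U) :
    ∃ W, IsAdmissible X.X₀ W ∧ x ∉ W ∧ ∀ U ∈ S, U ⊆ W := by
  obtain ⟨W, ⟨hW, hxW⟩, hSW⟩ := ((X.mem_iff_directed x).1 hx).exists_forall_rel_of_finite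
    ⟨∅, .empty X.order_dense, Set.notMem_empty x⟩ hS h
  exact ⟨W, hW, hxW, hSW⟩

/-- By compactness it suffices to exclude one point `y ∉ W` at a time. A maximal `x ≥ y` outside `W`
lies in `X₀` and misses `U` or `V`; directedness at `x` encloses that set together with `W` in an
admissible upset missing `x`, hence `y`. -/
theorem exists_isAdmissible_inter_eq {U V W : Set X} (hU : IsAdmissible X.X₀ U)
    (hV : IsAdmissible X.X₀ V) (hW : IsAdmissible X.X₀ W) (h : U ∩ V ⊆ W) :
    ∃ U' V', IsAdmissible X.X₀ U' ∧ IsAdmissible X.X₀ V' ∧ U ⊆ U' ∧ V ⊆ V' ∧ U' ∩ V' = W := by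
  obtain ⟨_, ⟨U', V', hU', hV', hUU', hVV', rfl⟩, hK⟩ :=
    hW.1.compl.isClosed.isCompact.exists_disjoint_of_directedOn
      (𝓐 := {A | ∃ U' V', IsAdmissible X.X₀ U' ∧ IsAdmissible X.X₀ V' ∧ U ∪ W ⊆ U' ∧ V ∪ W ⊆ V' ∧
        U' ∩ V' = A})
      ⟨_, Set.univ, Set.univ, .univ, .univ, Set.subset_univ _, Set.subset_univ _, rfl⟩
      (by
        rintro _ ⟨U₁, V₁, hU₁, hV₁, hUU₁, hVV₁, rfl⟩ _ ⟨U₂, V₂, hU₂, hV₂, hUU₂, hVV₂, rfl⟩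
        exact ⟨_, ⟨U₁ ∩ U₂, V₁ ∩ V₂, hU₁.inter hU₂, hV₁.inter hV₂, Set.subset_inter hUU₁ hUU₂,
          Set.subset_inter hVV₁ hVV₂, rfl⟩,
          Set.inter_subset_inter Set.inter_subset_left Set.inter_subset_left,
          Set.inter_subset_inter Set.inter_subset_right Set.inter_subset_right⟩)
      (by
        rintro _ ⟨U', V', hU', hV', _, _, rfl⟩
        exact (hU'.1.inter hV'.1).isClosed)
      (fun y hy => by
        obtain ⟨x, hyx, hx⟩ := PriestleySpace.exists_le_maximal hW.1.compl.isClosed hy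
        have key : ∀ T : Set X, IsAdmissible X.X₀ T → x ∉ T →
            ∃ T', IsAdmissible X.X₀ T' ∧ T ∪ W ⊆ T' ∧ y ∉ T' := by
          intro T hT hxT
          obtain ⟨T', hT', hxT', hle⟩ := exists_isAdmissible_of_finite (hW.2.2 x hx)
            (S := {T, W}) (by simp) (by rintro _ (rfl | rfl); exacts [⟨hT, hxT⟩, ⟨hW, hx.1⟩])
          exact ⟨T', hT', Set.union_subset (hle T (by simp)) (hle W (by simp)),
            fun h => hxT' (hT'.2.1 hyx h)⟩
        by_cases hxU : x ∈ U
        · obtain ⟨V', hV', hVV', hy'⟩ := key V hV fun hxV => hx.1 (h ⟨hxU, hxV⟩)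
          exact ⟨_, ⟨Set.univ, V', .univ, hV', Set.subset_univ _, hVV', rfl⟩, fun h => hy' h.2⟩
        · obtain ⟨U', hU', hUU', hy'⟩ := key U hU hxU
          exact ⟨_, ⟨U', Set.univ, hU', .univ, hUU', Set.subset_univ _, rfl⟩, fun h => hy' h.1⟩)
  rw [Set.union_subset_iff] at hUU' hVV'
  exact ⟨U', V', hU', hV', hUU'.1, hVV'.1,
    subset_antisymm (fun x hx => not_not.1 (hK x hx)) (Set.subset_inter hUU'.2 hVV'.2)⟩

/-- The bounded distributive meet-semilattice of admissible clopen upsets. -/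
def admissibles (X : GPSS.{u}) : BDMSS.{u} where
  carrier := {U : Set X // IsAdmissible X.X₀ U}
  semilatticeInf := Subtype.semilatticeInf fun {_ _} hU hV => IsAdmissible.inter hU hV
  boundedOrder :=
    { top := ⟨Set.univ, .univ⟩
      le_top := fun U => Set.subset_univ U.1
      bot := ⟨∅, .empty X.order_dense⟩
      bot_le := fun U => Set.empty_subset U.1 }
  distrib U V W h := by
    obtain ⟨U', V', hU', hV', hUU', hVV', e⟩ := exists_isAdmissible_inter_eq U.2 V.2 W.2 h
    exact ⟨⟨U', hU'⟩, ⟨V', hV'⟩, hUU', hVV', Subtype.ext e⟩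

/-- If `x` were in `U` but in no member of `S`, density would give such a point `y` in `X₀`.
Directedness at `y` then gives an upper bound of `S` missing `y`, which cannot contain `U`. -/
theorem isOptimal_setOf_mem (x : X) : BDMSS.IsOptimal (M := X.admissibles) {U | x ∈ U.1} where
  top_mem := Set.mem_univ x
  inf_mem_iff _ _ := Iff.rfl
  exists_mem S U hU hxU := by
    by_contra! hS
    have hop : IsOpen (U.1 ∩ ⋂ V ∈ S, V.1ᶜ) :=
      U.2.1.isOpen.inter (isOpen_biInter_finset fun V _ => V.2.1.compl.isOpen)
    obtain ⟨y, ⟨hyU, hyS⟩, hy⟩ := X.dense.inter_open_nonempty _ hop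
      ⟨x, hxU, Set.mem_iInter₂.2 hS⟩
    obtain ⟨W, hW, hyW, hSW⟩ := exists_isAdmissible_of_finite hy
      (S := Subtype.val '' (S : Set X.admissibles)) (S.finite_toSet.image _)
      (by
        rintro _ ⟨V, hV, rfl⟩
        exact ⟨V.2, Set.mem_iInter₂.1 hyS V hV⟩)
    exact hyW (hU (a := ⟨W, hW⟩) (fun V hV => hSW V.1 ⟨V, hV, rfl⟩) hyU)

/-- The optimal filter of admissible clopen upsets containing a point. -/
noncomputable def toSpec (x : X) : BDMSS.OptSpec X.admissibles :=
  .mk' _ (isOptimal_setOf_mem x)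

theorem toSpec_mem_basic {x : X} {U : X.admissibles} :
    toSpec x ∈ BDMSS.OptSpec.basic U ↔ x ∈ U.1 :=
  BDMSS.OptSpec.mk'_mem_basic

theorem toSpec_le_iff {x y : X} : toSpec x ≤ toSpec y ↔ x ≤ y := by
  rw [BDMSS.OptSpec.le_iff, X.le_iff]
  simp only [toSpec_mem_basic]
  exact ⟨fun h U hU => h ⟨U, hU⟩, fun h U => h U.1 U.2⟩

/-- If `F` came from no point, compactness would make some `U` in `F` covered by a finite set `S` of
admissible upsets outside `F`. Then `U` is below all upper bounds of `S`, against optimality. -/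
theorem toSpec_surjective : Function.Surjective (toSpec (X := X)) := by
  classical
  intro F
  by_contra! hF
  obtain ⟨_, ⟨U, S, hU, hS, rfl⟩, hK⟩ := (isCompact_univ (X := X)).exists_disjoint_of_directedOn
    (𝓐 := {A | ∃ (U : X.admissibles) (S : Finset X.admissibles), F ∈ BDMSS.OptSpec.basic U ∧
      (∀ V ∈ S, F ∉ BDMSS.OptSpec.basic V) ∧ U.1 ∩ ⋂ V ∈ S, V.1ᶜ = A})
    ⟨_, ⊤, ∅, F.2.top_mem, by simp, rfl⟩
    (by
      rintro _ ⟨U₁, S₁, hU₁, hS₁, rfl⟩ _ ⟨U₂, S₂, hU₂, hS₂, rfl⟩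
      refine ⟨_, ⟨U₁ ⊓ U₂, S₁ ∪ S₂, (F.2.inf_mem_iff U₁ U₂).2 ⟨hU₁, hU₂⟩, fun V hV =>
        (Finset.mem_union.1 hV).elim (hS₁ V) (hS₂ V), rfl⟩, ?_, ?_⟩
      · exact Set.inter_subset_inter Set.inter_subset_left
          (Set.biInter_subset_biInter_left fun V hV => Finset.mem_union_left _ hV)
      · exact Set.inter_subset_inter Set.inter_subset_right
          (Set.biInter_subset_biInter_left fun V hV => Finset.mem_union_right _ hV))
    (by
      rintro _ ⟨U, S, _, _, rfl⟩
      exact U.2.1.isClosed.inter (isClosed_biInter fun V _ => V.2.1.compl.isClosed))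
    (fun x _ => by
      by_contra! h
      refine hF x (BDMSS.OptSpec.ext_basic fun U => ?_)
      rw [toSpec_mem_basic]
      constructor
      · intro hx
        by_contra hU
        have := h _ ⟨⊤, {U}, F.2.top_mem, by simpa using hU, rfl⟩
        exact (Set.mem_iInter₂.1 this.2 U (by simp)) hx
      · intro hU
        exact (h _ ⟨U, ∅, hU, by simp, rfl⟩).1)
  obtain ⟨V, hV, hFV⟩ := F.2.exists_mem S U
    (by
      intro W hW x hxU
      by_contra hxW
      exact hK x ⟨hxU, Set.mem_iInter₂.2 fun V hV hxV => hxW (hW hV hxV)⟩ trivial) hU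
  exact hS V hV hFV

/-- A generalized Priestley space is order isomorphic to the space of optimal filters of its
admissible clopen upsets. -/
noncomputable def orderIsoSpec (X : GPSS.{u}) : X ≃o BDMSS.OptSpec X.admissibles :=
  .ofSurjective (.ofMapLEIff toSpec fun _ _ => toSpec_le_iff) toSpec_surjective

/-- A generalized Priestley space is isomorphic to the space of optimal filters of its
admissible clopen upsets. -/
noncomputable def isoSpec (X : GPSS.{u}) : X.admissibles.spec ≅ X where
  hom :=
    { toFun := X.orderIsoSpec.symm
      monotone := X.orderIsoSpec.symm.monotone
      -- Morphisms carry no separate continuity condition, so an order isomorphism that matches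
      -- admissible upsets is enough.
      preimage_admissible := fun U hU => by
        refine BDMSS.OptSpec.isAdmissible_iff.2 ⟨⟨U, hU⟩, Set.ext fun y => ?_⟩
        obtain ⟨x, rfl⟩ := X.orderIsoSpec.surjective y
        change X.orderIsoSpec x ∈ _ ↔ X.orderIsoSpec.symm (X.orderIsoSpec x) ∈ U
        rw [OrderIso.symm_apply_apply]
        exact toSpec_mem_basic }
  inv :=
    { toFun := X.orderIsoSpec
      monotone := X.orderIsoSpec.monotone
      preimage_admissible := fun U hU => by
        obtain ⟨V, rfl⟩ := BDMSS.OptSpec.isAdmissible_iff.1 hU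
        convert V.2
        exact Set.ext fun x => toSpec_mem_basic }
  hom_inv_id := GPSS.Hom.ext (funext X.orderIsoSpec.apply_symm_apply)
  inv_hom_id := GPSS.Hom.ext (funext X.orderIsoSpec.symm_apply_apply)

end GPSS

instance : BDMSS.specFunctor.{u}.EssSurj where
  mem_essImage X := ⟨Opposite.op X.admissibles, ⟨X.isoSpec⟩⟩

instance : BDMSS.specFunctor.{u}.IsEquivalence where

theorem mainTheorem5 :
    Nonempty (KAlgFrmS.{u} ≌ BDMSS.{u}) ∧
    Nonempty (KAlgFrmS.{u}ᵒᵖ ≌ GPSS.{u}) ∧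
    Nonempty (BDMSS.{u}ᵒᵖ ≌ GPSS.{u}) :=
  ⟨⟨KAlgFrmS.compactsFunctor.asEquivalence⟩,
    ⟨KAlgFrmS.compactsFunctor.asEquivalence.op.trans BDMSS.specFunctor.asEquivalence⟩,
    ⟨BDMSS.specFunctor.asEquivalence⟩⟩
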